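/- For a number field $M$ let $D_M$ denote the absolute value of its discriminant. Let $D_6\le S_6$ be the dihedral group of order $12$ acting on the six vertices of a regular hexagon, and let $L$ be a $D_6$-sextic field, i.e. a number field of degree $6$ such that the Galois group of its Galois closure $L^c$ over $\mathbb{Q}$, acting on the six embeddings $L\hookrightarrow L^c$, is isomorphic to $D_6$ as a permutation group. Let $F$ be the cubic subfield and $K$ the quadratic subfield of $L$, and put $$C(L) := \frac{D_L}{D_F D_K}.$$ Then $$C(L) = \frac{D_F D_K^2}{C\,m^2},$$ where $C = 2^a 3^b$ for some integers $0\le a\le 9$ and $0\le b\le 3$, and $m$ is the product of the primes $p>3$ that divide both $D_F$ and $D_K$. -/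

import Mathlib

noncomputable section

/-- `D_M`: the absolute value of the discriminant of the number field `M`. -/
def absDiscr (M : Type*) [Field M] [NumberField M] : ℕ :=
  (NumberField.discr M).natAbs

/-- The Galois closure of the number field `L`, inside `ℂ`: the
compositum of the images of all embeddings of `L`. -/
abbrev GaloisClosure (L : Type*) [Field L] [NumberField L] :
    IntermediateField ℚ ℂ :=
  IntermediateField.normalClosure ℚ L ℂ

/-- `L ∈ NF_n(G)`, for a subgroup `G` of `S_n`: the number field `L` has degree `n`, and the
Galois group of its Galois closure, acting by composition on the embeddings of `L` into the
Galois closure, is isomorphic to `G` as a permutation group. -/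
def IsNumberFieldWithGroup (n : ℕ) (G : Subgroup (Equiv.Perm (Fin n)))
    (L : Type*) [Field L] [NumberField L] : Prop :=
  Module.finrank ℚ L = n ∧
    ∃ (φ : (GaloisClosure L ≃ₐ[ℚ] GaloisClosure L) ≃* G)
      (e : (L →ₐ[ℚ] GaloisClosure L) ≃ Fin n),
      ∀ (σ : GaloisClosure L ≃ₐ[ℚ] GaloisClosure L) (τ : L →ₐ[ℚ] GaloisClosure L),
        e ((σ : GaloisClosure L →ₐ[ℚ] GaloisClosure L).comp τ) =
          (φ σ : Equiv.Perm (Fin n)) (e τ)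

/-- The dihedral group `D_6` of order `12` as a subgroup of `S_6`, the symmetries of a regular
hexagon acting on its vertices: it is generated by the rotation `i ↦ i + 1 mod 6` and the
reflection `i ↦ 5 - i`. -/
def dihedralSix : Subgroup (Equiv.Perm (Fin 6)) :=
  Subgroup.closure {finRotate 6, Fin.revPerm}

/-- A `D_6`-sextic field. -/
def IsD6Sextic (L : Type*) [Field L] [NumberField L] : Prop :=
  IsNumberFieldWithGroup 6 dihedralSix L

/-- `C(L) = D_L / (D_F D_K)`, for the cubic subfield `F` and the quadratic subfield `K` of a
`D_6`-sextic field `L`. -/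
def sexticConductor (L : Type*) [Field L] [NumberField L] (F K : IntermediateField ℚ L) : ℚ :=
  (absDiscr L : ℚ) / ((absDiscr F : ℚ) * (absDiscr K : ℚ))

/-- The product `m` of the primes `p > 3` that divide both (nonzero) numbers `x` and `y`. -/
def commonPrimeProduct (x y : ℕ) : ℕ :=
  ∏ p ∈ x.primeFactors ∩ y.primeFactors with 3 < p, p

end

/-!
As their degrees are coprime, `F` and `K` are linearly disjoint over `ℚ`, with compositum `L`. Write
`𝔇` for the different of `L / F` and `N` for its absolute norm, so that `D_L = N D_F²`.

* The different of `K`, extended to `L`, is `𝔇 * I` for an ideal `I` of `𝓞 L`; taking norms,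
  `D_K³ = N · N(I)`, and the tower `L / K / ℚ` gives `N(I) ∣ D_F²` as well. Hence
  `C(L) = D_F N / D_K = D_F D_K² / N(I)`, and the task is to compute `N(I)`.
* Products of integral bases of `F` and `K` form a basis of `L` of discriminant
  `disc(F)² disc(K)³`. This differs from `disc(L)` by a square, so `N(I) = s²` is a perfect square
  (`exists_absNorm_differentIdeal_mul_sq`).
* For a quadratic field, `p ^ (2 * k) ∣ D_K` forces `p ^ k ∣ 2`
  (`prime_pow_dvd_two_of_pow_dvd_discr`): otherwise all traces would be divisible by `p ^ k`, but
  the trace of `1` is `2`. So `v_p(D_K) ≤ 1` for odd `p` and `v_2(D_K) ≤ 3`. With `s² ∣ D_K³` this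
  gives `v_p(s) ≤ 1` for odd `p` and `v_2(s) ≤ 4`.
* If an odd prime `p` ramifies in both `F` and `K`, then `p ∣ s` (`dvd_absNorm_of_dvd_discr`).
  Indeed `P² ∣ p` for a prime `P` of `F`, and `p = Q²` in `K`, so `P ∣ Q` in `L`, and `Q` divides the
  different of `K`. If `I` were prime to `p`, then `P ∣ 𝔇`, so all traces from `L` to `F` would lie
  in `P`, contradicting that the trace of `1` is `2`. So the
  decomposition of `p` in `L` need not be known.

Consequently `s = 2 ^ a * 3 ^ b * m` with `a ≤ 4` and `b ≤ 1`.
-/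

open NumberField

/-! ### Traces and the different -/

-- The fraction field of `B` as an algebra over the fraction field of `A`.
attribute [local instance] FractionRing.liftAlgebra

section Trace

variable (A K L B : Type*) [CommRing A] [CommRing B] [Field K] [Field L] [Algebra A K]
  [Algebra B L] [Algebra A B] [Algebra K L] [Algebra A L] [IsScalarTower A K L]
  [IsScalarTower A B L] [IsDedekindDomain A] [IsDedekindDomain B] [Module.IsTorsionFree A B]
  [Module.Finite A B] [IsFractionRing A K] [IsFractionRing B L]
  [Algebra.IsSeparable (FractionRing A) (FractionRing B)] [FiniteDimensional K L]

/-- If an ideal `I` of `A`, extended to `B`, divides the different, then every trace lies in `I`;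
the trace of `1` is the degree. -/
theorem finrank_mem_of_map_dvd_differentIdeal {I : Ideal A}
    (h : I.map (algebraMap A B) ∣ differentIdeal A B) : (Module.finrank K L : A) ∈ I := by
  have key : Algebra.intTrace A B 1 = Module.finrank K L := by
    apply FaithfulSMul.algebraMap_injective A K
    rw [Algebra.algebraMap_intTrace (L := L), map_one, map_natCast,
      ← map_one (algebraMap K L), Algebra.trace_algebraMap, nsmul_one]
  by_contra hI
  exact not_dvd_differentIdeal_of_intTrace_not_mem A (I.map (algebraMap A B)) ⊤
    (Ideal.mul_top _) 1 trivial (key ▸ hI) h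

end Trace

/-! ### Ramified primes -/

/-- A prime dividing the discriminant has a prime above it with ramification index at least `2`,
which moreover divides the different. -/
theorem exists_sq_dvd_of_dvd_discr (M : Type*) [Field M] [NumberField M] {p : ℕ} (hp : p.Prime)
    (h : p ∣ (discr M).natAbs) :
    ∃ P : Ideal (𝓞 M), P.IsMaximal ∧ P.under ℤ = .span {(p : ℤ)} ∧
      P ^ 2 ∣ Ideal.span {(p : 𝓞 M)} ∧ P ∣ differentIdeal ℤ (𝓞 M) := by
  rw [← absNorm_differentIdeal M (𝓞 M)] at h
  obtain ⟨P, hP, hPp, hd⟩ := Ideal.exists_isMaximal_dvd_of_dvd_absNorm' hp _ h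
  refine ⟨P, hP, hPp, ?_, hd⟩
  have hmap : Ideal.map (algebraMap ℤ (𝓞 M)) (.span {(p : ℤ)}) = .span {(p : 𝓞 M)} := by
    simp [Ideal.map_span]
  obtain ⟨Q, hQ⟩ : P ∣ Ideal.span {(p : 𝓞 M)} := by
    rw [← hmap, ← hPp, Ideal.dvd_iff_le]
    exact Ideal.map_comap_le
  have : (Ideal.span {(p : ℤ)}).IsMaximal := PrincipalIdealRing.isMaximal_of_irreducible
    (Nat.prime_iff_prime_int.mp hp).irreducible
  have : Finite (ℤ ⧸ Ideal.span {(p : ℤ)}) :=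
    Ideal.finiteQuotientOfFreeOfNeBot _ (by simpa using hp.ne_zero)
  rw [hQ, sq]
  by_contra hPQ
  -- Otherwise `p = P * Q` with `P`, `Q` coprime; finite residue fields being perfect, `P` is then
  -- unramified and cannot divide the different.
  refine not_dvd_differentIdeal_of_isCoprime ℤ P Q ?_ (hmap.trans hQ).symm hd
  have : ¬ P ∣ Q := fun ⟨R, hR⟩ ↦ hPQ ⟨R, by rw [hR, mul_assoc]⟩
  rw [Ideal.dvd_iff_le] at this
  obtain ⟨x, hx, hx'⟩ := SetLike.not_le_iff_exists.mp this
  rw [Ideal.isCoprime_iff_sup_eq]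
  exact hP.out.2 _ (lt_of_le_of_ne le_sup_left fun e ↦ hx' (e ▸ le_sup_right (a := P) hx))

/-! ### Discriminants of quadratic fields -/

section Quadratic

variable (M : Type*) [Field M] [NumberField M]

/-- In a quadratic field, a prime dividing the discriminant is totally ramified. -/
theorem exists_sq_eq_of_dvd_discr (hM : Module.finrank ℚ M = 2) {p : ℕ} (hp : p.Prime)
    (h : p ∣ (discr M).natAbs) :
    ∃ P : Ideal (𝓞 M), P.IsMaximal ∧ P ^ 2 = Ideal.span {(p : 𝓞 M)} ∧
      P.absNorm = p ∧ P ∣ differentIdeal ℤ (𝓞 M) := by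
  obtain ⟨P, hP, -, ⟨J, hJ⟩, hd⟩ := exists_sq_dvd_of_dvd_discr M hp h
  have hn : p ^ 2 = P.absNorm ^ 2 * J.absNorm := by
    rw [← map_pow, ← map_mul, ← hJ, Ideal.absNorm_span_natCast, RingOfIntegers.rank, hM]
  have hPn : P.absNorm = p := by
    refine (hp.eq_one_or_self_of_dvd _ ?_).resolve_left
      (Ideal.absNorm_eq_one_iff.not.mpr hP.ne_top)
    exact (Nat.pow_dvd_pow_iff two_ne_zero).mp ⟨_, hn⟩
  have hJ1 : J.absNorm = 1 := by
    rw [hPn] at hn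
    exact (Nat.mul_eq_left (pow_pos hp.pos 2).ne').mp hn.symm
  rw [Ideal.absNorm_eq_one_iff] at hJ1
  exact ⟨P, hP, by rw [hJ, hJ1, Ideal.mul_top], hPn, hd⟩

/-- The bounds `v_p(D) ≤ 1` for odd `p` and `v_2(D) ≤ 3` for the discriminant `D` of a quadratic
field, in a uniform form. -/
theorem prime_pow_dvd_two_of_pow_dvd_discr (hM : Module.finrank ℚ M = 2) {p : ℕ} (hp : p.Prime)
    {k : ℕ} (h : p ^ (2 * k) ∣ (discr M).natAbs) : p ^ k ∣ 2 := by
  rcases Nat.eq_zero_or_pos k with rfl | hk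
  · simp
  obtain ⟨P, hP, hsq, hn, -⟩ :=
    exists_sq_eq_of_dvd_discr M hM hp ((dvd_pow_self p (by positivity)).trans h)
  have hPunit : ¬ IsUnit P := Ideal.isUnit_iff.not.mpr hP.ne_top
  have hfin : FiniteMultiplicity P (differentIdeal ℤ (𝓞 M)) :=
    FiniteMultiplicity.of_not_isUnit hPunit differentIdeal_ne_bot
  obtain ⟨I, hI, hPI⟩ := hfin.exists_eq_pow_mul_and_not_dvd
  set j := multiplicity P (differentIdeal ℤ (𝓞 M))
  -- `P` is the only prime above `p`, so the `p`-part of the discriminant is the norm of `P ^ j`.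
  have hcop : ¬ p ∣ I.absNorm := fun hpI ↦ by
    obtain ⟨Q, hQ, hQp, hQI⟩ := Ideal.exists_isMaximal_dvd_of_dvd_absNorm' hp _ hpI
    have hpQ : (p : 𝓞 M) ∈ Q := by
      have : (p : ℤ) ∈ Q.under ℤ := hQp ▸ Ideal.mem_span_singleton_self _
      simpa [Ideal.under, Ideal.mem_comap] using this
    have hle : P ≤ Q := Ideal.IsPrime.le_of_pow_le (n := 2)
      (hsq ▸ (Ideal.span_singleton_le_iff_mem _).mpr hpQ)
    exact hPI (hP.eq_of_le hQ.ne_top hle ▸ hQI)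
  have hle : 2 * k ≤ j := by
    rw [← absNorm_differentIdeal M (𝓞 M), hI, map_mul, map_pow, hn] at h
    exact (Nat.pow_dvd_pow_iff_le_right hp.one_lt).mp
      ((Nat.Coprime.pow_left _ ((hp.coprime_iff_not_dvd).mpr hcop)).dvd_of_dvd_mul_right h)
  have hdvd : Ideal.map (algebraMap ℤ (𝓞 M)) (.span {((p ^ k : ℕ) : ℤ)}) ∣
      differentIdeal ℤ (𝓞 M) := by
    rw [Ideal.map_span, Set.image_singleton, eq_intCast, Int.cast_natCast, Nat.cast_pow,
      ← Ideal.span_singleton_pow, ← hsq, ← pow_mul]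
    exact (pow_dvd_pow P hle).trans ⟨I, hI⟩
  have := finrank_mem_of_map_dvd_differentIdeal ℤ ℚ M (𝓞 M) hdvd
  rw [hM, Ideal.mem_span_singleton] at this
  exact_mod_cast this

end Quadratic

/-! ### Discriminants of composita -/

theorem exists_discr_basis_eq_sq_mul_discr (M : Type*) [Field M] [NumberField M] {ι : Type*}
    [Fintype ι] [DecidableEq ι] (b : Module.Basis ι ℚ M) :
    ∃ t : ℚ, Algebra.discr ℚ b = t ^ 2 * discr M := by
  have e := (integralBasis M).indexEquiv b
  refine ⟨(((integralBasis M).reindex e).toMatrix b).det, ?_⟩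
  conv_lhs => rw [← ((integralBasis M).reindex e).toMatrix_map_vecMul b]
  rw [Algebra.discr_of_matrix_vecMul, Module.Basis.coe_reindex, Algebra.discr_reindex, coe_discr]

theorem IntermediateField.LinearDisjoint.exists_basis_discr_eq {k E : Type*} [Field k] [Field E]
    [Algebra k E] [FiniteDimensional k E] {A B : IntermediateField k E} (h₁ : A.LinearDisjoint B)
    (h₂ : A ⊔ B = ⊤) {ι κ : Type*} [Fintype ι] [Fintype κ] [DecidableEq ι] [DecidableEq κ]
    (a : Module.Basis ι k A) (b : Module.Basis κ k B) :
    ∃ c : Module.Basis (ι × κ) k E, Algebra.discr k c =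
      Algebra.discr k a ^ Fintype.card κ * Algebra.discr k b ^ Fintype.card ι := by
  have h₂' : A.toSubalgebra ⊔ B.toSubalgebra = ⊤ := by
    rw [← IntermediateField.sup_toSubalgebra_of_left, h₂, IntermediateField.top_toSubalgebra]
  refine ⟨a.smulTower (h₁.basisOfBasisRight h₂' b), ?_⟩
  rw [Algebra.discr_def, Algebra.discr_def, Algebra.discr_def, ← Matrix.det_kronecker]
  congr 1
  ext ⟨i, r⟩ ⟨j, s⟩
  simp only [Matrix.kroneckerMap_apply, Algebra.traceMatrix_apply, Algebra.traceForm_apply,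
    Module.Basis.smulTower_apply, IntermediateField.LinearDisjoint.basisOfBasisRight_apply]
  rw [smul_mul_smul_comm, ← map_mul (algebraMap B E), ← Algebra.trace_trace (S := A), map_smul,
    h₁.trace_algebraMap h₂, smul_eq_mul, mul_comm, ← Algebra.smul_def, map_smul, smul_eq_mul,
    mul_comm]

section Compositum

variable {L : Type*} [Field L] [NumberField L] {F K : IntermediateField ℚ L}

/-- The products of integral bases of `F` and `K` form a basis of `L`, whose discriminant differs
from that of `L` by the square of the determinant of a change of basis. -/
theorem exists_discr_pow_mul_discr_pow_eq (h₁ : F.LinearDisjoint K) (h₂ : F ⊔ K = ⊤) :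
    ∃ t : ℚ, (discr F : ℚ) ^ Module.finrank ℚ K * (discr K : ℚ) ^ Module.finrank ℚ F =
      t ^ 2 * discr L := by
  classical
  obtain ⟨c, hc⟩ := h₁.exists_basis_discr_eq h₂ (integralBasis F) (integralBasis K)
  obtain ⟨t, ht⟩ := exists_discr_basis_eq_sq_mul_discr L c
  refine ⟨t, ?_⟩
  rw [← ht, coe_discr, coe_discr, Module.finrank_eq_card_basis (integralBasis F),
    Module.finrank_eq_card_basis (integralBasis K)]
  exact hc.symm

theorem exists_map_differentIdeal_eq_mul (h₁ : F.LinearDisjoint K) (h₂ : F ⊔ K = ⊤) :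
    ∃ I : Ideal (𝓞 L), (differentIdeal ℤ (𝓞 K)).map (algebraMap (𝓞 K) (𝓞 L)) =
        differentIdeal (𝓞 F) (𝓞 L) * I ∧
      (discr K).natAbs ^ Module.finrank ℚ F =
        (differentIdeal (𝓞 F) (𝓞 L)).absNorm * I.absNorm := by
  obtain ⟨I, hI⟩ :=
    IsDedekindDomain.differentIdeal_dvd_map_differentIdeal ℤ (𝓞 L) (𝓞 F) (𝓞 K) h₁ h₂
  refine ⟨I, hI, ?_⟩
  rw [← map_mul, ← hI, Ideal.absNorm_algebraMap, absNorm_differentIdeal K,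
    ← IsFractionRing.finrank_eq (𝓞 K) K (𝓞 L) L, h₁.finrank_right_eq_finrank h₂]

/-- An odd prime that ramifies in both `F` and the quadratic field `K` divides the norm of the
quotient `I` of the different of `K` by the different of `L / F`. -/
theorem dvd_absNorm_of_dvd_discr (h₁ : F.LinearDisjoint K) (h₂ : F ⊔ K = ⊤)
    (hK : Module.finrank ℚ K = 2) {I : Ideal (𝓞 L)}
    (hI : (differentIdeal ℤ (𝓞 K)).map (algebraMap (𝓞 K) (𝓞 L)) =
      differentIdeal (𝓞 F) (𝓞 L) * I)
    {p : ℕ} (hp : p.Prime) (hp2 : p ≠ 2)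
    (hpF : p ∣ (discr F).natAbs) (hpK : p ∣ (discr K).natAbs) : p ∣ I.absNorm := by
  by_contra hpq
  obtain ⟨P, hP, hPp, ⟨R, hR⟩, -⟩ := exists_sq_dvd_of_dvd_discr F hp hpF
  obtain ⟨Q, -, hQ, -, hQd⟩ := exists_sq_eq_of_dvd_discr K hK hp hpK
  have hpP : (p : 𝓞 F) ∈ P := by
    have : (p : ℤ) ∈ P.under ℤ := hPp ▸ Ideal.mem_span_singleton_self _
    simpa [Ideal.under, Ideal.mem_comap] using this
  have hPQ : P.map (algebraMap (𝓞 F) (𝓞 L)) ∣ Q.map (algebraMap (𝓞 K) (𝓞 L)) := by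
    rw [← UniqueFactorizationMonoid.pow_dvd_pow_iff_dvd two_ne_zero, ← Ideal.map_pow,
      ← Ideal.map_pow, hQ, Ideal.map_span, Set.image_singleton, map_natCast]
    refine ⟨R.map (algebraMap (𝓞 F) (𝓞 L)), ?_⟩
    rw [← Ideal.map_mul, ← hR, Ideal.map_span, Set.image_singleton, map_natCast]
  have hcop : IsCoprime (P.map (algebraMap (𝓞 F) (𝓞 L))) I := by
    rw [Ideal.isCoprime_iff_exists]
    have : IsCoprime (p : ℤ) I.absNorm :=
      Nat.isCoprime_iff_coprime.mpr ((hp.coprime_iff_not_dvd).mpr hpq)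
    obtain ⟨u, v, huv⟩ := this
    refine ⟨u * p, Ideal.mul_mem_left _ _ ?_, v * I.absNorm,
      Ideal.mul_mem_left _ _ I.absNorm_mem, by exact_mod_cast huv⟩
    simpa using Ideal.mem_map_of_mem (algebraMap (𝓞 F) (𝓞 L)) hpP
  have hPd : P.map (algebraMap (𝓞 F) (𝓞 L)) ∣ differentIdeal (𝓞 F) (𝓞 L) :=
    hcop.dvd_of_dvd_mul_right (hI ▸ hPQ.trans (_root_.map_dvd (Ideal.mapHom _) hQd))
  -- The trace of `1` from `L` to `F` is `2`, which together with `p` generates the unit ideal.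
  have h2 := finrank_mem_of_map_dvd_differentIdeal (𝓞 F) F L (𝓞 L) hPd
  rw [h₁.finrank_left_eq_finrank h₂, hK] at h2
  have : IsCoprime (p : ℤ) (2 : ℕ) :=
    Nat.isCoprime_iff_coprime.mpr ((Nat.coprime_primes hp Nat.prime_two).mpr hp2)
  obtain ⟨u, v, huv⟩ := this
  refine hP.ne_top ((Ideal.eq_top_iff_one _).mpr ?_)
  have h1 : (u * p + v * (2 : ℕ) : 𝓞 F) = 1 := by exact_mod_cast huv
  exact h1 ▸ P.add_mem (P.mul_mem_left _ hpP) (P.mul_mem_left _ h2)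

end Compositum

/-! ### Prime factorization -/

section Arithmetic

variable {x y s : ℕ}

/-- The arithmetic core: the shape of `s` follows from its divisibility properties, read with
`x = D_F` and `y = D_K`. -/
theorem eq_two_pow_mul_three_pow_mul_commonPrimeProduct (hx : x ≠ 0) (hy : y ≠ 0)
    (hsx : s ^ 2 ∣ x ^ 2) (hsy : s ^ 2 ∣ y ^ 3)
    (hxy : ∀ p : ℕ, p.Prime → p ≠ 2 → p ∣ x → p ∣ y → p ∣ s)
    (hy2 : ∀ p k : ℕ, p.Prime → p ^ (2 * k) ∣ y → p ^ k ∣ 2) :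
    ∃ a b : ℕ, a ≤ 4 ∧ b ≤ 1 ∧ s = 2 ^ a * 3 ^ b * commonPrimeProduct x y := by
  have hs : s ≠ 0 := by
    rintro rfl
    simp [hx] at hsx
  have bound : ∀ p j : ℕ, p.Prime → p ^ j ∣ s → 2 * j ≤ 3 * y.factorization p := by
    intro p j hp hj
    have : p ^ (2 * j) ∣ y ^ 3 := by
      rw [mul_comm, pow_mul]
      exact (pow_dvd_pow_of_dvd hj 2).trans hsy
    simpa using (hp.pow_dvd_iff_le_factorization (pow_ne_zero 3 hy)).mp this
  have bound_odd : ∀ p j : ℕ, p.Prime → p ≠ 2 → p ^ j ∣ s → j ≤ 1 := by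
    intro p j hp hp2 hj
    by_contra! hj1
    have := bound p j hp hj
    have : p ^ (2 * 1) ∣ y := (hp.pow_dvd_iff_le_factorization hy).mpr (by omega)
    have := hy2 p 1 hp this
    rw [pow_one] at this
    exact hp2 ((Nat.prime_dvd_prime_iff_eq hp Nat.prime_two).mp this)
  obtain ⟨a, u, hu, rfl⟩ := Nat.exists_eq_pow_mul_and_not_dvd hs 2 (by norm_num)
  have hu0 : u ≠ 0 := right_ne_zero_of_mul hs
  obtain ⟨b, r, hr, rfl⟩ := Nat.exists_eq_pow_mul_and_not_dvd hu0 3 (by norm_num)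
  have hr0 : r ≠ 0 := right_ne_zero_of_mul hu0
  have hrs : r ∣ 2 ^ a * (3 ^ b * r) := ⟨2 ^ a * 3 ^ b, by ring⟩
  have hr2 : ¬ 2 ∣ r := fun h ↦ hu (h.mul_left _)
  refine ⟨a, b, ?_, bound_odd 3 b Nat.prime_three (by norm_num) ⟨2 ^ a * r, by ring⟩, ?_⟩
  · by_contra! ha
    have := bound 2 a Nat.prime_two ⟨_, rfl⟩
    have : 2 ^ (2 * 2) ∣ y := (Nat.prime_two.pow_dvd_iff_le_factorization hy).mpr (by omega)
    exact absurd (hy2 2 2 Nat.prime_two this) (by norm_num)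
  have hsq : Squarefree r := by
    rw [Nat.squarefree_iff_prime_squarefree]
    intro p hp hpr
    have := bound_odd p 2 hp (by rintro rfl; exact hr2 (dvd_of_mul_left_dvd hpr))
      ((sq p ▸ hpr).trans hrs)
    omega
  have hprimes : r.primeFactors = (x.primeFactors ∩ y.primeFactors).filter (3 < ·) := by
    ext p
    simp only [Finset.mem_filter, Finset.mem_inter, Nat.mem_primeFactors]
    constructor
    · rintro ⟨hp, hpr, -⟩
      have hps := hpr.trans hrs
      have hp2 : p ≠ 2 := by rintro rfl; exact hr2 hpr
      have hp3 : p ≠ 3 := by rintro rfl; exact hr hpr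
      exact ⟨⟨⟨hp, hps.trans ((Nat.pow_dvd_pow_iff two_ne_zero).mp hsx), hx⟩, hp,
        hp.dvd_of_dvd_pow (((dvd_pow_self p two_ne_zero).trans (pow_dvd_pow_of_dvd hps 2)).trans
          hsy), hy⟩, by have := hp.two_le; omega⟩
    · rintro ⟨⟨⟨hp, hpx, -⟩, -, hpy, -⟩, hp3⟩
      refine ⟨hp, ?_, hr0⟩
      have hps := hxy p hp (by omega) hpx hpy
      have h2 := (Nat.coprime_primes hp Nat.prime_two).mpr (by omega)
      have h3 := (Nat.coprime_primes hp Nat.prime_three).mpr (by omega)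
      exact (h3.pow_right b).dvd_of_dvd_mul_left ((h2.pow_right a).dvd_of_dvd_mul_left hps)
  rw [commonPrimeProduct, ← hprimes, Nat.prod_primeFactors_of_squarefree hsq, mul_assoc]

end Arithmetic

/-! ### The relative different of the sextic field -/

/-- The norm of the relative different of `L / F` is `D_K³ / s²`, where `s` is supported at primes
dividing `D_F` and `D_K` and is divisible by all odd such primes. -/
theorem exists_absNorm_differentIdeal_mul_sq {L : Type*} [Field L] [NumberField L]
    {F K : IntermediateField ℚ L} (h₁ : F.LinearDisjoint K) (h₂ : F ⊔ K = ⊤)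
    (hF : Module.finrank ℚ F = 3) (hK : Module.finrank ℚ K = 2) :
    ∃ s : ℕ, absDiscr K ^ 3 = (differentIdeal (𝓞 F) (𝓞 L)).absNorm * s ^ 2 ∧
      s ^ 2 ∣ absDiscr F ^ 2 ∧
      ∀ p : ℕ, p.Prime → p ≠ 2 → p ∣ absDiscr F → p ∣ absDiscr K → p ∣ s := by
  obtain ⟨I, hI, hN⟩ := exists_map_differentIdeal_eq_mul h₁ h₂
  obtain ⟨t, ht⟩ := exists_discr_pow_mul_discr_pow_eq h₁ h₂
  have hLF := natAbs_discr_eq_absNorm_differentIdeal_mul_natAbs_discr_pow F (𝓞 F) L (𝓞 L)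
  have hLK := natAbs_discr_eq_absNorm_differentIdeal_mul_natAbs_discr_pow K (𝓞 K) L (𝓞 L)
  rw [h₁.finrank_left_eq_finrank h₂, hK] at hLF
  rw [h₁.finrank_right_eq_finrank h₂, hF] at hLK
  rw [hF] at hN
  rw [hF, hK] at ht
  have hF0 : absDiscr F ≠ 0 := Int.natAbs_ne_zero.mpr (discr_ne_zero F)
  have hK0 : absDiscr K ≠ 0 := Int.natAbs_ne_zero.mpr (discr_ne_zero K)
  change absDiscr L = _ * absDiscr F ^ 2 at hLF
  change absDiscr L = _ * absDiscr K ^ 3 at hLK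
  change absDiscr K ^ 3 = _ at hN
  have hcast : ∀ (M : Type _) [Field M] [NumberField M], |(discr M : ℚ)| = absDiscr M :=
    fun M _ _ ↦ by rw [absDiscr, Nat.cast_natAbs, Int.cast_abs]
  have ht' : (absDiscr F : ℚ) ^ 2 * (absDiscr K : ℚ) ^ 3 = t ^ 2 * absDiscr L := by
    rw [← hcast F, ← hcast K, ← hcast L, ← abs_pow, ← abs_pow, ← abs_mul, ht, abs_mul, abs_sq]
  have hD0 : (differentIdeal (𝓞 F) (𝓞 L)).absNorm ≠ 0 :=
    fun h ↦ pow_ne_zero 3 hK0 (by rw [hN, h, zero_mul])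
  -- Both `N(I)` and `t ^ 2` equal `D_K³ / N`, as `D_L = N D_F²`.
  have htI : (I.absNorm : ℚ) = t ^ 2 := by
    have hN' : (absDiscr K : ℚ) ^ 3 = (differentIdeal (𝓞 F) (𝓞 L)).absNorm * I.absNorm := by
      exact_mod_cast hN
    rw [hLF, hN'] at ht'
    push_cast at ht'
    have h0 : ((absDiscr F : ℚ) ^ 2 * (differentIdeal (𝓞 F) (𝓞 L)).absNorm) ≠ 0 := by
      have : ((differentIdeal (𝓞 F) (𝓞 L)).absNorm : ℚ) ≠ 0 := by exact_mod_cast hD0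
      positivity
    apply mul_left_cancel₀ h0
    linear_combination ht'
  obtain ⟨s, hs⟩ : IsSquare I.absNorm :=
    Rat.isSquare_natCast_iff.mp ⟨t, by rw [htI, sq]⟩
  rw [← sq] at hs
  refine ⟨s, by rw [hN, hs], ⟨(differentIdeal (𝓞 K) (𝓞 L)).absNorm, ?_⟩,
    fun p hp hp2 hpF hpK ↦
      hp.dvd_of_dvd_pow (hs ▸ dvd_absNorm_of_dvd_discr h₁ h₂ hK hI hp hp2 hpF hpK)⟩
  apply Nat.eq_of_mul_eq_mul_left (Nat.pos_of_ne_zero hD0)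
  rw [← hLF, hLK, hN, hs]
  ring

/-! ### Computation of the conductor -/

theorem proposition4 (L : Type*) [Field L] [NumberField L] (hL : IsD6Sextic L)
    (F K : IntermediateField ℚ L)
    (hF : Module.finrank ℚ F = 3) (hK : Module.finrank ℚ K = 2) :
    ∃ a b : ℕ, a ≤ 9 ∧ b ≤ 3 ∧
      sexticConductor L F K =
        ((absDiscr F : ℚ) * (absDiscr K : ℚ) ^ 2) /
          (((2 : ℚ) ^ a * (3 : ℚ) ^ b) *
            (commonPrimeProduct (absDiscr F) (absDiscr K) : ℚ) ^ 2) := by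
  have h₁ : F.LinearDisjoint K := .of_finrank_coprime (by rw [hF, hK]; norm_num)
  have h₂ : F ⊔ K = ⊤ := IntermediateField.eq_of_le_of_finrank_eq le_top (by
    rw [h₁.finrank_sup, hF, hK, IntermediateField.finrank_top', hL.1])
  have hF0 : absDiscr F ≠ 0 := Int.natAbs_ne_zero.mpr (discr_ne_zero F)
  have hK0 : absDiscr K ≠ 0 := Int.natAbs_ne_zero.mpr (discr_ne_zero K)
  obtain ⟨s, hs, hsF, hps⟩ := exists_absNorm_differentIdeal_mul_sq h₁ h₂ hF hK
  obtain ⟨a, b, ha, hb, hab⟩ := eq_two_pow_mul_three_pow_mul_commonPrimeProduct hF0 hK0 hsF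
    ⟨_, hs.trans (mul_comm _ _)⟩ hps
    fun p k hp h ↦ prime_pow_dvd_two_of_pow_dvd_discr K hK hp h
  refine ⟨2 * a, 2 * b, by omega, by omega, ?_⟩
  have hLF := natAbs_discr_eq_absNorm_differentIdeal_mul_natAbs_discr_pow F (𝓞 F) L (𝓞 L)
  rw [h₁.finrank_left_eq_finrank h₂, hK] at hLF
  change absDiscr L = _ * absDiscr F ^ 2 at hLF
  have hden : (2 : ℚ) ^ (2 * a) * 3 ^ (2 * b) *
      (commonPrimeProduct (absDiscr F) (absDiscr K) : ℚ) ^ 2 = (s : ℚ) ^ 2 := by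
    rw [hab]
    push_cast
    ring
  have hs0 : (s : ℚ) ≠ 0 := by
    rintro h
    rw [Nat.cast_eq_zero.mp h] at hs
    exact pow_ne_zero 3 hK0 (by simpa using hs)
  have hs' : (absDiscr K : ℚ) ^ 3 = (differentIdeal (𝓞 F) (𝓞 L)).absNorm * (s : ℚ) ^ 2 := by
    exact_mod_cast hs
  rw [hden, sexticConductor, hLF]
  push_cast
  field_simp
  linear_combination -hs'
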